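/- **Conventions.** All simplicial complexes are finite abstract simplicial complexes; $V(K)$ is the vertex set of $K$ and $S_i(K)$ the set of its $i$-faces (faces with $i+1$ vertices). We write $F\in\partial\bar F$ if $F\subset\bar F$ are faces with $|\bar F|=|F|+1$. A weight on $K$ is a positive function $w_K$ on the faces of $K$. The real cochain group $C^i(K,\mathbb R)=\mathrm{Hom}(C_i(K,\mathbb R),\mathbb R)$ carries the inner product $\langle f,g\rangle=\sum_{F\in S_i(K)}w_K(F)f([F])g([F])$, where $[F]$ is $F$ with any chosen orientation. With $\delta_i:C^i(K,\mathbb R)\to C^{i+1}(K,\mathbb R)$ the coboundary map, $\mathcal L_i^{\mathrm{up}}(K)=\delta_i^*\delta_i$. An incidence-signed complex $(M,s)$ is a complex $M$ with a function $s(F,\bar F)\in\{-1,0,1\}$ on pairs of faces which is $\pm1$ if $F\in\partial\bar F$ and $0$ otherwise. Its coboundary map is $$(\delta_i^sf)([v_0,\dots,v_{i+1}])=\sum_{j=0}^{i+1}(-1)^j\,s\big(\{v_0,\dots,\widehat{v_j},\dots,v_{i+1}\},\{v_0,\dots,v_{i+1}\}\big)\,f([v_0,\dots,\widehat{v_j},\dots,v_{i+1}]),$$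 and $\mathcal L_i^{\mathrm{up}}(M,s)=(\delta_i^s)^*\delta_i^s$. $\operatorname{Spec}$ denotes the multiset of eigenvalues. A ($2$-fold, strong) covering $\phi:K\to M$ is a simplicial map such that $K$ is connected (its $1$-skeleton is a connected graph); for each nonempty face $G$ of $M$ the faces $F$ of $K$ with $\phi(F)=G$ are pairwise disjoint, are mapped bijectively onto $G$ by $\phi$, have union $\phi^{-1}(G)\subseteq V(K)$, and are exactly $2$ in number; and whenever $G\in\partial\bar G$ in $M$ and $\phi(F)=G$, there is a face $\bar F$ of $K$ with $F\in\partial\bar F$ and $\phi(\bar F)=\bar G$. The $i$-th incidence graph $B_i(K)$ is the bipartite graph on $S_i(K)\cup S_{i+1}(K)$ in which $F$ and $\bar F$ are adjacent iff $F\in\partial\bar F$. A permutation assignment $\psi$ on $B_i(M)$ assigns to each arc $(u,v)$ of $B_i(M)$ an element $\psi(u,v)$ of the symmetric group $\mathbb S_2$ on $\{1,2\}$ with $\psi(v,u)=\psi(u,v)^{-1}$. The derived graph $B_i(M)^\psi$ has vertices $(u,a)$, $a\in\{1,2\}$, where $(u,a)$ and $(v,b)$ are adjacent iff $u,v$ are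 adjacent in $B_i(M)$ and $a=\psi(u,v)(b)$. **Theorem.** Let $\phi:K\to M$ be a $2$-fold covering, let $w_K,w_M$ be weights with $w_K(F)=w_M(\phi(F))$ for all faces $F$ of $K$, and let $i\ge0$. Then there is a permutation assignment $\psi$ on $B_i(M)$ with values in $\mathbb S_2$ for which there is a graph isomorphism $\eta:B_i(M)^\psi\to B_i(K)$ with $\phi(\eta(G,a))=G$ for all vertices $(G,a)$. For every such $\psi$ and every incidence-signed complex $(M,s)$ with $s(F,\bar F)=\operatorname{sgn}\psi(F,\bar F)$ for all $F\in S_i(M)$, $\bar F\in S_{i+1}(M)$ with $F\in\partial\bar F$ (such $s$ exist), one has, as a multiset union (multiplicities added), $$\operatorname{Spec}\mathcal L_i^{\mathrm{up}}(K)=\operatorname{Spec}\mathcal L_i^{\mathrm{up}}(M)\ \cup\ \operatorname{Spec}\mathcal L_i^{\mathrm{up}}(M,s).$$ -/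

import Mathlib

noncomputable section

/-- `F.Incident F'`, written `F ∈ ∂F'` in the usual notation: `F` arises from `F'` by deleting
exactly one vertex. -/
def Finset.Incident {V : Type*} (F F' : Finset V) : Prop :=
  F ⊆ F' ∧ F'.card = F.card + 1

namespace AbstractSimplicialComplex

variable {V W : Type*}

/-! ### Faces, ordered faces and real chains

Mathlib's `AbstractSimplicialComplex V` lists the nonempty faces only, and its vertex set is all of
`V`.  The empty simplex plays no role in the dimensions `i ≥ 0` considered here. -/

/-- The set `S_i(K)` of `i`-faces, that is, of faces with `i + 1` vertices. -/
def Face (K : AbstractSimplicialComplex V) (i : ℕ) : Type _ :=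
  {F : K // F.1.card = i + 1}

instance [Finite V] (K : AbstractSimplicialComplex V) (i : ℕ) : Finite (K.Face i) :=
  inferInstanceAs (Finite {F : K // F.1.card = i + 1})

instance [Finite V] (K : AbstractSimplicialComplex V) (i : ℕ) : Fintype (K.Face i) :=
  Fintype.ofFinite _

/-- An `i`-face together with an ordering `v₀, …, v_i` of its vertices. -/
def OrderedFace (K : AbstractSimplicialComplex V) (i : ℕ) : Type _ :=
  {t : Fin (i + 1) ↪ V // Finset.univ.map t ∈ K}

namespace OrderedFace

variable {K : AbstractSimplicialComplex V} {i : ℕ}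

instance [Finite V] : Finite (K.OrderedFace i) :=
  inferInstanceAs (Finite {t : Fin (i + 1) ↪ V // Finset.univ.map t ∈ K})

/-- The underlying face `{v₀, …, v_i}`. -/
def toFace (t : K.OrderedFace i) : K := ⟨Finset.univ.map t.1, t.2⟩

theorem map_perm (σ : Equiv.Perm (Fin (i + 1))) (t : Fin (i + 1) ↪ V) :
    Finset.univ.map (σ.toEmbedding.trans t) = Finset.univ.map t := by
  rw [← Finset.map_map]
  simp

/-- The reordering `(v_{σ 0}, …, v_{σ i})`. -/
def perm (t : K.OrderedFace i) (σ : Equiv.Perm (Fin (i + 1))) : K.OrderedFace i :=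
  ⟨σ.toEmbedding.trans t.1, by rw [map_perm]; exact t.2⟩

/-- The ordered face `(v₀, …, v̂_j, …, v_{i+1})` obtained by omitting `v_j`. -/
def erase (t : K.OrderedFace (i + 1)) (j : Fin (i + 2)) : K.OrderedFace i :=
  ⟨(Fin.succAboveEmb j).trans t.1, by
    refine (K.isRelLowerSet_faces t.2).2 ?_ (by simp)
    rw [← Finset.map_map]
    exact Finset.map_subset_map.2 (Finset.subset_univ _)⟩

theorem toFace_perm (t : K.OrderedFace i) (σ : Equiv.Perm (Fin (i + 1))) :
    (t.perm σ).toFace = t.toFace :=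
  Subtype.ext (map_perm σ t.1)

theorem exists_perm_of_toFace_eq {t t' : K.OrderedFace i} (h : t.toFace = t'.toFace) :
    ∃ σ, t' = t.perm σ := by
  have h' : ∀ x, ∃ y, t.1 y = t'.1 x := by
    intro x
    have hx : t'.1 x ∈ t.toFace.1 := by rw [h]; simp [toFace]
    simpa [toFace] using hx
  choose σ hσ using h'
  have hinj : Function.Injective σ := fun a b hab => t'.1.injective (by rw [← hσ, ← hσ, hab])
  refine ⟨Equiv.ofBijective σ (Finite.injective_iff_bijective.1 hinj), Subtype.ext ?_⟩
  ext x
  exact (hσ x).symm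

/-- Omitting the `j`-th vertex after a reordering `σ` amounts to omitting the `σ j`-th vertex and
reordering by some `τ` with `sgn σ · (-1)^{σ j} = (-1)^j · sgn τ`. -/
theorem exists_erase_perm (t : K.OrderedFace (i + 1)) (σ : Equiv.Perm (Fin (i + 2)))
    (j : Fin (i + 2)) :
    ∃ τ : Equiv.Perm (Fin (i + 1)), (t.perm σ).erase j = (t.erase (σ j)).perm τ ∧
      ((-1 : ℤ) ^ (j : ℕ)) * (Equiv.Perm.sign τ : ℤ) =
        (Equiv.Perm.sign σ : ℤ) * (-1) ^ (σ j : ℕ) := by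
  set ρ : Equiv.Perm (Fin (i + 2)) := (Fin.cycleRange (σ j)) * σ * (Fin.cycleRange j)⁻¹ with hρ
  have h0 : ρ 0 = 0 := by
    simp [hρ, Equiv.Perm.mul_apply, Equiv.Perm.inv_def, Fin.cycleRange_symm_zero,
      Fin.cycleRange_self]
  obtain ⟨⟨p, τ⟩, hτ⟩ := Equiv.Perm.decomposeFin.symm.surjective ρ
  have hp : p = 0 := by
    have := congrArg (fun e : Equiv.Perm (Fin (i + 2)) => e 0) hτ
    simpa [h0] using this
  subst hp
  refine ⟨τ, Subtype.ext ?_, ?_⟩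
  · ext x
    have hx : ρ x.succ = (τ x).succ := by
      rw [← hτ]; simp
    have hx' : σ (j.succAbove x) = (σ j).succAbove (τ x) := by
      rw [← Fin.cycleRange_symm_succ, ← Fin.cycleRange_symm_succ, ← hx]
      simp [hρ, Equiv.Perm.mul_apply, Equiv.Perm.inv_def]
    exact congrArg t.1 hx'
  · have hs : Equiv.Perm.sign ρ = Equiv.Perm.sign τ := by
      rw [← hτ]; simp
    rw [← hs, hρ]
    simp only [map_mul, map_inv, Fin.sign_cycleRange]
    rcases Nat.even_or_odd (j : ℕ) with hj | hj <;>
      rcases Nat.even_or_odd (σ j : ℕ) with hk | hk <;>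
      simp [hj.neg_one_pow, hk.neg_one_pow]

end OrderedFace

/-- The relations `[v_{σ 0}, …, v_{σ i}] = sgn σ · [v₀, …, v_i]` between ordered faces. -/
def orientationRelations (K : AbstractSimplicialComplex V) (i : ℕ) :
    Submodule ℝ (K.OrderedFace i →₀ ℝ) :=
  Submodule.span ℝ {x | ∃ (t : K.OrderedFace i) (σ : Equiv.Perm (Fin (i + 1))),
    x = Finsupp.single (t.perm σ) 1 - Finsupp.single t ((Equiv.Perm.sign σ : ℤ) : ℝ)}

/-- The chain group `C_i(K, ℝ)`: generated by the oriented `i`-faces, two opposite orientations of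
the same face being negatives of each other. -/
abbrev Chain (K : AbstractSimplicialComplex V) (i : ℕ) : Type _ :=
  (K.OrderedFace i →₀ ℝ) ⧸ K.orientationRelations i

/-- The oriented face `[v₀, …, v_i]` as a chain. -/
def OrderedFace.toChain {K : AbstractSimplicialComplex V} {i : ℕ} (t : K.OrderedFace i) :
    K.Chain i :=
  (K.orientationRelations i).mkQ (Finsupp.single t 1)

theorem OrderedFace.toChain_perm {K : AbstractSimplicialComplex V} {i : ℕ} (t : K.OrderedFace i)
    (σ : Equiv.Perm (Fin (i + 1))) :
    (t.perm σ).toChain = ((Equiv.Perm.sign σ : ℤ) : ℝ) • t.toChain := by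
  rw [toChain, toChain, ← map_smul, ← sub_eq_zero, ← map_sub]
  rw [Submodule.mkQ_apply, Submodule.Quotient.mk_eq_zero]
  exact Submodule.subset_span ⟨t, σ, by simp⟩

/-! ### Incidence-signed complexes and (signed) boundary maps -/

/-- The sign function of an incidence-signed complex `(K, s)`: `s (F, F')` is `1` or `-1` if
`F ∈ ∂F'`, and `0` otherwise. -/
structure IncidenceSign (K : AbstractSimplicialComplex V) where
  toFun : K → K → SignType
  ne_zero_iff : ∀ F F' : K, toFun F F' ≠ 0 ↔ F.1.Incident F'.1

open Classical in
/-- The sign function that is `1` on every incidence; it gives back the ordinary complex `K`. -/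
def IncidenceSign.one (K : AbstractSimplicialComplex V) : K.IncidenceSign where
  toFun F F' := if F.1.Incident F'.1 then 1 else 0
  ne_zero_iff F F' := by simp

/-- The signed boundary map `∂^s : C_{i+1}(K, ℝ) → C_i(K, ℝ)`,
`∂^s [v₀, …, v_{i+1}] = ∑ j, (-1)^j s(F_j, F) [v₀, …, v̂_j, …, v_{i+1}]`, where
`F = {v₀, …, v_{i+1}}` and `F_j = F \ {v_j}`. -/
def signedBoundary (K : AbstractSimplicialComplex V) (s : K.IncidenceSign) (i : ℕ) :
    K.Chain (i + 1) →ₗ[ℝ] K.Chain i :=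
  (K.orientationRelations (i + 1)).liftQ
    (Finsupp.linearCombination ℝ fun t : K.OrderedFace (i + 1) =>
      ∑ j : Fin (i + 2),
        ((-1 : ℝ) ^ (j : ℕ) * (s.toFun (t.erase j).toFace t.toFace : ℝ)) • (t.erase j).toChain)
    (by
      rw [orientationRelations, Submodule.span_le]
      rintro _ ⟨t, σ, rfl⟩
      simp only [SetLike.mem_coe, LinearMap.mem_ker, map_sub, Finsupp.linearCombination_single,
        one_smul, sub_eq_zero, Finset.smul_sum]
      rw [← Equiv.sum_comp σ (fun j : Fin (i + 2) => ((Equiv.Perm.sign σ : ℤ) : ℝ) •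
        ((-1 : ℝ) ^ (j : ℕ) * (s.toFun (t.erase j).toFace t.toFace : ℝ)) • (t.erase j).toChain)]
      refine Finset.sum_congr rfl fun j _ => ?_
      obtain ⟨τ, h, hs⟩ := t.exists_erase_perm σ j
      have hs' := congrArg (Int.cast : ℤ → ℝ) hs
      push_cast at hs'
      rw [h, OrderedFace.toFace_perm, OrderedFace.toFace_perm, OrderedFace.toChain_perm,
        smul_smul, smul_smul]
      congr 1
      linear_combination (s.toFun (t.erase (σ j)).toFace t.toFace : ℝ) * hs')

theorem signedBoundary_toChain (K : AbstractSimplicialComplex V) (s : K.IncidenceSign) (i : ℕ)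
    (t : K.OrderedFace (i + 1)) :
    K.signedBoundary s i t.toChain = ∑ j : Fin (i + 2),
      ((-1 : ℝ) ^ (j : ℕ) * (s.toFun (t.erase j).toFace t.toFace : ℝ)) •
        (t.erase j).toChain := by
  rw [signedBoundary, OrderedFace.toChain, Submodule.mkQ_apply, Submodule.liftQ_apply,
    Finsupp.linearCombination_single, one_smul]

/-- The ordinary boundary map, i.e. the one with `s = 1` on all incidences. -/
def boundary (K : AbstractSimplicialComplex V) (i : ℕ) : K.Chain (i + 1) →ₗ[ℝ] K.Chain i :=
  K.signedBoundary (IncidenceSign.one K) i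

theorem boundary_toChain (K : AbstractSimplicialComplex V) (i : ℕ) (t : K.OrderedFace (i + 1)) :
    K.boundary i t.toChain = ∑ j : Fin (i + 2), (-1 : ℝ) ^ (j : ℕ) • (t.erase j).toChain := by
  rw [boundary, signedBoundary_toChain]
  refine Finset.sum_congr rfl fun j _ => ?_
  have h : (t.erase j).toFace.1.Incident t.toFace.1 := by
    refine ⟨?_, by simp [OrderedFace.toFace]⟩
    simp only [OrderedFace.toFace, OrderedFace.erase]
    rw [← Finset.map_map]
    exact Finset.map_subset_map.2 (Finset.subset_univ _)
  simp [IncidenceSign.one, h]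

/-! ### Weights, cochains and the up Laplace operators -/

/-- A positive weight on the faces of `K`. -/
structure FaceWeight (K : AbstractSimplicialComplex V) where
  toFun : K → ℝ
  pos : ∀ F, 0 < toFun F

/-- The cochain group `C^i(K, ℝ) = Hom(C_i(K, ℝ), ℝ)`; the weight is recorded in the type because it
determines the inner product. -/
def Cochain (K : AbstractSimplicialComplex V) (_w : K.FaceWeight) (i : ℕ) : Type _ :=
  Module.Dual ℝ (K.Chain i)

/-- A choice of an orientation of every `i`-face. -/
def Face.orient {K : AbstractSimplicialComplex V} {i : ℕ} (F : K.Face i) : K.OrderedFace i :=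
  ⟨(F.1.1.equivFinOfCardEq F.2).symm.toEmbedding.trans (Function.Embedding.subtype _), by
    convert F.1.2 using 1
    ext x
    simp only [Finset.mem_map, Finset.mem_univ, true_and, Function.Embedding.trans_apply,
      Equiv.coe_toEmbedding, Function.Embedding.subtype_apply]
    exact ⟨by rintro ⟨a, rfl⟩; exact Subtype.prop _,
      fun hx => ⟨F.1.1.equivFinOfCardEq F.2 ⟨x, hx⟩, by simp⟩⟩⟩

theorem Face.toFace_orient {K : AbstractSimplicialComplex V} {i : ℕ} (F : K.Face i) :
    F.orient.toFace = F.1 := by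
  apply Subtype.ext
  ext x
  simp only [OrderedFace.toFace, Face.orient, Finset.mem_map, Finset.mem_univ, true_and,
    Function.Embedding.trans_apply, Equiv.coe_toEmbedding, Function.Embedding.subtype_apply]
  exact ⟨by rintro ⟨a, rfl⟩; exact Subtype.prop _,
    fun hx => ⟨F.1.1.equivFinOfCardEq F.2 ⟨x, hx⟩, by simp⟩⟩

namespace Cochain

variable {K : AbstractSimplicialComplex V} {w : K.FaceWeight} {i : ℕ}

instance : AddCommGroup (K.Cochain w i) := inferInstanceAs (AddCommGroup (Module.Dual ℝ (K.Chain i)))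

instance : Module ℝ (K.Cochain w i) := inferInstanceAs (Module ℝ (Module.Dual ℝ (K.Chain i)))

instance [Finite V] : FiniteDimensional ℝ (K.Cochain w i) :=
  inferInstanceAs (FiniteDimensional ℝ (Module.Dual ℝ (K.Chain i)))

/-- The value `f([v₀, …, v_i])`. -/
def eval (f : K.Cochain w i) (t : K.OrderedFace i) : ℝ :=
  (show Module.Dual ℝ (K.Chain i) from f) t.toChain

theorem eval_perm (f : K.Cochain w i) (t : K.OrderedFace i) (σ : Equiv.Perm (Fin (i + 1))) :
    f.eval (t.perm σ) = ((Equiv.Perm.sign σ : ℤ) : ℝ) * f.eval t := by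
  rw [eval, OrderedFace.toChain_perm, map_smul, smul_eq_mul, eval]

theorem ext_eval {f g : K.Cochain w i} (h : ∀ t, f.eval t = g.eval t) : f = g := by
  refine Submodule.linearMap_qext _ (Finsupp.lhom_ext' fun t => LinearMap.ext_ring ?_)
  exact h t

/-- The product `f([F]) g([F])` does not depend on the orientation of `F`. -/
theorem eval_mul_eval (f g : K.Cochain w i) {t t' : K.OrderedFace i} (h : t.toFace = t'.toFace) :
    f.eval t * g.eval t = f.eval t' * g.eval t' := by
  obtain ⟨σ, rfl⟩ := OrderedFace.exists_perm_of_toFace_eq h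
  rw [eval_perm, eval_perm]
  rcases Int.units_eq_one_or (Equiv.Perm.sign σ) with h | h <;> simp [h]

variable [Finite V]

/-- The weighted inner product `⟨f, g⟩ = ∑ F ∈ S_i(K), w(F) f([F]) g([F])`. -/
@[reducible]
def innerCore : InnerProductSpace.Core ℝ (K.Cochain w i) where
  inner f g := ∑ F : K.Face i, w.toFun F.1 * (f.eval F.orient * g.eval F.orient)
  conj_inner_symm f g := by simp [mul_comm]
  re_inner_nonneg f := by
    simp only [RCLike.re_to_real]
    exact Finset.sum_nonneg fun F _ => mul_nonneg (w.pos _).le (mul_self_nonneg _)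
  add_left f g h := by
    rw [← Finset.sum_add_distrib]
    refine Finset.sum_congr rfl fun F _ => ?_
    rw [show (f + g).eval F.orient = f.eval F.orient + g.eval F.orient from rfl]
    ring
  smul_left f g r := by
    rw [Finset.mul_sum]
    refine Finset.sum_congr rfl fun F _ => ?_
    rw [show (r • f).eval F.orient = r * f.eval F.orient from rfl]
    simp only [conj_trivial]
    ring
  definite f hf := by
    refine ext_eval fun t => ?_
    rw [Finset.sum_eq_zero_iff_of_nonneg
      (fun F _ => mul_nonneg (w.pos _).le (mul_self_nonneg _))] at hf
    have h := hf ⟨t.toFace, by simp [OrderedFace.toFace]⟩ (Finset.mem_univ _)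
    rw [mul_eq_zero, or_iff_right (w.pos _).ne',
      eval_mul_eval f f (t' := t) (Face.toFace_orient _)] at h
    exact mul_self_eq_zero.1 h

instance : NormedAddCommGroup (K.Cochain w i) := innerCore.toNormedAddCommGroup

instance : InnerProductSpace ℝ (K.Cochain w i) := InnerProductSpace.ofCore innerCore.toCore

theorem inner_eq (f g : K.Cochain w i) :
    inner ℝ f g = ∑ F : K.Face i, w.toFun F.1 * (f.eval F.orient * g.eval F.orient) := rfl

end Cochain

/-- The signed coboundary map `δ^s : C^i(K, ℝ) → C^{i+1}(K, ℝ)`, `δ^s f = f ∘ ∂^s`. -/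
def signedCoboundary [Finite V] (K : AbstractSimplicialComplex V) (w : K.FaceWeight)
    (s : K.IncidenceSign) (i : ℕ) : K.Cochain w i →ₗ[ℝ] K.Cochain w (i + 1) :=
  (K.signedBoundary s i).dualMap

/-- The coboundary map `δ : C^i(K, ℝ) → C^{i+1}(K, ℝ)`, `δ f = f ∘ ∂`. -/
def coboundary [Finite V] (K : AbstractSimplicialComplex V) (w : K.FaceWeight) (i : ℕ) :
    K.Cochain w i →ₗ[ℝ] K.Cochain w (i + 1) :=
  (K.boundary i).dualMap

theorem signedCoboundary_eval [Finite V] (K : AbstractSimplicialComplex V) (w : K.FaceWeight)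
    (s : K.IncidenceSign) (i : ℕ) (f : K.Cochain w i) (t : K.OrderedFace (i + 1)) :
    (K.signedCoboundary w s i f).eval t = ∑ j : Fin (i + 2),
      ((-1 : ℝ) ^ (j : ℕ) * (s.toFun (t.erase j).toFace t.toFace : ℝ)) * f.eval (t.erase j) := by
  let f' : Module.Dual ℝ (K.Chain i) := f
  change f' (K.signedBoundary s i t.toChain) = _
  rw [signedBoundary_toChain, map_sum]
  exact Finset.sum_congr rfl fun j _ => map_smul f' _ _

theorem coboundary_eval [Finite V] (K : AbstractSimplicialComplex V) (w : K.FaceWeight) (i : ℕ)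
    (f : K.Cochain w i) (t : K.OrderedFace (i + 1)) :
    (K.coboundary w i f).eval t =
      ∑ j : Fin (i + 2), (-1 : ℝ) ^ (j : ℕ) * f.eval (t.erase j) := by
  let f' : Module.Dual ℝ (K.Chain i) := f
  change f' (K.boundary i t.toChain) = _
  rw [boundary_toChain, map_sum]
  exact Finset.sum_congr rfl fun j _ => map_smul f' _ _

/-- The `i`-up Laplace operator `δ* δ` of the weighted complex `K`. -/
def upLaplacian [Finite V] (K : AbstractSimplicialComplex V) (w : K.FaceWeight) (i : ℕ) :
    K.Cochain w i →ₗ[ℝ] K.Cochain w i :=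
  LinearMap.adjoint (K.coboundary w i) ∘ₗ K.coboundary w i

/-- The `i`-up Laplace operator `(δ^s)* δ^s` of the weighted incidence-signed complex `(K, s)`. -/
def signedUpLaplacian [Finite V] (K : AbstractSimplicialComplex V) (w : K.FaceWeight)
    (s : K.IncidenceSign) (i : ℕ) : K.Cochain w i →ₗ[ℝ] K.Cochain w i :=
  LinearMap.adjoint (K.signedCoboundary w s i) ∘ₗ K.signedCoboundary w s i

/-! ### Simplicial maps and coverings -/

/-- The 1-skeleton of `K` as a graph. -/
def skeletonGraph (K : AbstractSimplicialComplex V) : SimpleGraph V where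
  Adj u v := u ≠ v ∧ ∃ F ∈ K, (F : Set V) = {u, v}
  symm := ⟨fun _ _ h => ⟨h.1.symm, by simpa only [Set.pair_comm] using h.2⟩⟩
  loopless := ⟨fun _ h => h.1 rfl⟩

/-- A simplicial map `K → M`: a map between the vertex sets sending faces to faces. -/
structure SimplicialMap [DecidableEq W] (K : AbstractSimplicialComplex V)
    (M : AbstractSimplicialComplex W) where
  toFun : V → W
  image_mem : ∀ F ∈ K, F.image toFun ∈ M

namespace SimplicialMap

variable [DecidableEq W] {K : AbstractSimplicialComplex V} {M : AbstractSimplicialComplex W}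

/-- The induced map on faces, `F ↦ φ(F)`. -/
def mapFace (φ : SimplicialMap K M) (F : K) : M := ⟨F.1.image φ.toFun, φ.image_mem F.1 F.2⟩

/-- `φ : K → M` is a covering map: `K` is connected, and for each face `G` of `M` the faces of `K`
lying over `G` are pairwise disjoint, are mapped bijectively onto `G`, and have union `φ⁻¹(G)`. -/
structure IsCovering (φ : SimplicialMap K M) : Prop where
  connected : K.skeletonGraph.Connected
  bijOn : ∀ (G : M) (F : K), φ.mapFace F = G → Set.BijOn φ.toFun F.1 G.1
  disjoint : ∀ (G : M) (F F' : K), φ.mapFace F = G → φ.mapFace F' = G → F ≠ F' → Disjoint F.1 F'.1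
  preimage_eq : ∀ G : M, φ.toFun ⁻¹' (G.1 : Set W) = ⋃ F ∈ {F : K | φ.mapFace F = G}, (F.1 : Set V)

/-- A strong covering: whenever `G ∈ ∂G'` in `M`, each face `F` over `G` lies in the boundary of a
face over `G'`. -/
structure IsStrongCovering (φ : SimplicialMap K M) : Prop extends φ.IsCovering where
  lift : ∀ G G' : M, G.1.Incident G'.1 → ∀ F : K, φ.mapFace F = G →
    ∃ F' : K, F.1.Incident F'.1 ∧ φ.mapFace F' = G'

/-- A `k`-fold covering: a strong covering of degree `k`, i.e. every (nonempty) face of `M` has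
exactly `k` faces of `K` above it. -/
structure IsFoldCovering (φ : SimplicialMap K M) (k : ℕ) : Prop extends φ.IsStrongCovering where
  card_fiber : ∀ G : M, Nat.card {F : K // φ.mapFace F = G} = k

end SimplicialMap

/-! ### Incidence graphs and their description by permutation voltages -/

/-- The vertex set `S_i(K) ∪ S_{i+1}(K)` of the `i`-th incidence graph. -/
abbrev IncidenceVertex (K : AbstractSimplicialComplex V) (i : ℕ) : Type _ :=
  {F : K // F.1.card = i + 1 ∨ F.1.card = i + 2}

/-- The `i`-th incidence graph `B_i(K)`: an `i`-face `F` is joined to an `(i+1)`-face `F'` if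
`F ∈ ∂F'`. -/
def incidenceGraph (K : AbstractSimplicialComplex V) (i : ℕ) :
    SimpleGraph (K.IncidenceVertex i) where
  Adj F F' := F.1.1.Incident F'.1.1 ∨ F'.1.1.Incident F.1.1
  symm := ⟨fun _ _ h => h.symm⟩
  loopless := ⟨fun F h => by rcases h with h | h <;> exact absurd h.2 (by omega)⟩

end AbstractSimplicialComplex

/-- A permutation assignment `ψ : E(G) → 𝕊_k` on the arcs of the symmetric digraph of `G`, with
`ψ(e⁻¹) = ψ(e)⁻¹`. -/
structure SimpleGraph.PermVoltage {α : Type*} (G : SimpleGraph α) (k : ℕ) where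
  toFun : G.Dart → Equiv.Perm (Fin k)
  map_symm : ∀ e : G.Dart, toFun e.symm = (toFun e)⁻¹

/-- The derived graph `G^ψ` on `V(G) × [k]`: `(u, a)` and `(v, b)` are adjacent if `u` and `v` are
and `a = ψ(u, v)(b)`. -/
def SimpleGraph.PermVoltage.derivedGraph {α : Type*} {G : SimpleGraph α} {k : ℕ}
    (ψ : G.PermVoltage k) : SimpleGraph (α × Fin k) where
  Adj p q := ∃ h : G.Adj p.1 q.1, p.2 = ψ.toFun ⟨(p.1, q.1), h⟩ q.2
  symm := ⟨by
    rintro p q ⟨h, hp⟩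
    refine ⟨h.symm, ?_⟩
    have := ψ.map_symm ⟨(p.1, q.1), h⟩
    rw [show (⟨(q.1, p.1), h.symm⟩ : G.Dart) = (⟨(p.1, q.1), h⟩ : G.Dart).symm from rfl, this, hp]
    simp⟩
  loopless := ⟨fun p ⟨h, _⟩ => G.loopless.irrefl p.1 h⟩

namespace AbstractSimplicialComplex

variable {V W : Type*} [DecidableEq W] {K : AbstractSimplicialComplex V}
  {M : AbstractSimplicialComplex W}

/-- `ψ` describes `φ` on the `i`-th incidence graphs: there is a graph isomorphism
`η : B_i(M)^ψ ≅ B_i(K)` over `B_i(M)`, i.e. with `φ(η(G, a)) = G`. -/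
def SimplicialMap.IsDerivedBy (φ : SimplicialMap K M) {i k : ℕ}
    (ψ : (M.incidenceGraph i).PermVoltage k) : Prop :=
  ∃ η : ψ.derivedGraph ≃g K.incidenceGraph i,
    ∀ (G : M.IncidenceVertex i) (a : Fin k), φ.mapFace (η (G, a)).1 = G.1

/-- `s(F, F') = sgn ψ(F, F')` for all `F ∈ S_i(M)`, `F' ∈ S_{i+1}(M)` with `F ∈ ∂F'`. -/
def IncidenceSign.IsSignOf {i k : ℕ} (s : M.IncidenceSign)
    (ψ : (M.incidenceGraph i).PermVoltage k) : Prop :=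
  ∀ e : (M.incidenceGraph i).Dart, e.fst.1.1.Incident e.snd.1.1 →
    (s.toFun e.fst.1 e.snd.1 : ℤ) = (Equiv.Perm.sign (ψ.toFun e) : ℤ)

end AbstractSimplicialComplex

/-- The spectrum of a real operator as a multiset: the complex eigenvalues, each repeated according
to its algebraic multiplicity. -/
def LinearMap.specMultiset {E : Type*} [AddCommGroup E] [Module ℝ E] [FiniteDimensional ℝ E]
    (T : E →ₗ[ℝ] E) : Multiset ℂ :=
  T.charpoly.aroots ℂ

end

/-!
Let `ε` be a function on the faces of `K` with values `1` and `-1` on the two sheets over each face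
of `M`.  The pullback of cochains along `φ` and the pullback multiplied by `ε` have orthogonal
ranges, both double inner products, and together they span `C^i(K)`.  The first intertwines the
coboundary maps of `M` and `K`.  If `ε` is read off from the numbering `η` of the sheets, crossing
an incidence multiplies `ε` by the sign of the corresponding permutation, so the second intertwines
the signed coboundary map of `(M, s)` with that of `K`.  Hence `δ*δ` on `K` is conjugate to the
direct sum of the two up-Laplacians on `M`.

The permutation assignment exists because, once each fibre is numbered, every incidence in `M` lifts
uniquely from either end: to a subface by injectivity of `φ` on faces, and to a larger face by
counting.
-/

namespace SimplicialCovering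

open AbstractSimplicialComplex SimplicialMap

section LinearAlgebra

open LinearMap

theorem specMultiset_eq_add_of_charpoly_eq_mul {E E₁ E₂ : Type*}
    [AddCommGroup E] [Module ℝ E] [FiniteDimensional ℝ E]
    [AddCommGroup E₁] [Module ℝ E₁] [FiniteDimensional ℝ E₁]
    [AddCommGroup E₂] [Module ℝ E₂] [FiniteDimensional ℝ E₂]
    {T : E →ₗ[ℝ] E} {T₁ : E₁ →ₗ[ℝ] E₁} {T₂ : E₂ →ₗ[ℝ] E₂}
    (h : T.charpoly = T₁.charpoly * T₂.charpoly) :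
    T.specMultiset = T₁.specMultiset + T₂.specMultiset := by
  rw [specMultiset, h, Polynomial.aroots_mul
    (mul_ne_zero T₁.charpoly_monic.ne_zero T₂.charpoly_monic.ne_zero)]
  rfl

variable {𝕜 E E₁ E₂ F F₁ F₂ : Type*} [RCLike 𝕜]
  [NormedAddCommGroup E] [InnerProductSpace 𝕜 E]
  [NormedAddCommGroup E₁] [InnerProductSpace 𝕜 E₁]
  [NormedAddCommGroup E₂] [InnerProductSpace 𝕜 E₂]
  [NormedAddCommGroup F] [InnerProductSpace 𝕜 F]
  [NormedAddCommGroup F₁] [InnerProductSpace 𝕜 F₁]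
  [NormedAddCommGroup F₂] [InnerProductSpace 𝕜 F₂]

/-- A pair of linear maps with orthogonal ranges, both of which scale inner products by `c`.  For
`c = 1` and jointly spanning ranges this is an orthogonal decomposition `E = E₁ ⊕ E₂`. -/
structure IsOrthogonalPair (c : 𝕜) (A : E₁ →ₗ[𝕜] E) (B : E₂ →ₗ[𝕜] E) : Prop where
  inner_left : ∀ x y, inner 𝕜 (A x) (A y) = c * inner 𝕜 x y
  inner_right : ∀ x y, inner 𝕜 (B x) (B y) = c * inner 𝕜 x y
  inner_left_right : ∀ x y, inner 𝕜 (A x) (B y) = 0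

namespace IsOrthogonalPair

variable {c : 𝕜} {A : E₁ →ₗ[𝕜] E} {B : E₂ →ₗ[𝕜] E} {A' : F₁ →ₗ[𝕜] F} {B' : F₂ →ₗ[𝕜] F}
  {d : E →ₗ[𝕜] F} {d₁ : E₁ →ₗ[𝕜] F₁} {d₂ : E₂ →ₗ[𝕜] F₂}

theorem symm (h : IsOrthogonalPair c A B) : IsOrthogonalPair c B A where
  inner_left := h.inner_right
  inner_right := h.inner_left
  inner_left_right x y := inner_eq_zero_symm.1 (h.inner_left_right y x)

theorem eq_zero_of_add_eq_zero (h : IsOrthogonalPair c A B) (hc : c ≠ 0) {x : E₁} {y : E₂}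
    (hxy : A x + B y = 0) : x = 0 := by
  have hx : c * inner 𝕜 x x = 0 := by
    rw [← h.inner_left, ← add_zero (inner 𝕜 (A x) (A x)), ← h.inner_left_right x y,
      ← inner_add_right, hxy, inner_zero_right, h.inner_left_right]
  simpa [hc] using hx

theorem injective_coprod (h : IsOrthogonalPair c A B) (hc : c ≠ 0) :
    Function.Injective (A.coprod B) := by
  rw [← ker_eq_bot, ker_eq_bot']
  rintro ⟨x, y⟩ (hxy : A x + B y = 0)
  exact Prod.ext (h.eq_zero_of_add_eq_zero hc hxy)
    (h.symm.eq_zero_of_add_eq_zero hc ((add_comm _ _).trans hxy))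

variable [FiniteDimensional 𝕜 E] [FiniteDimensional 𝕜 F]
  [FiniteDimensional 𝕜 E₁] [FiniteDimensional 𝕜 F₁]

theorem adjoint_comp_self_apply (h : IsOrthogonalPair c A B) (h' : IsOrthogonalPair c A' B')
    (hsurj : Function.Surjective (A.coprod B)) (hA : d ∘ₗ A = A' ∘ₗ d₁) (hB : d ∘ₗ B = B' ∘ₗ d₂)
    (x : E₁) : (adjoint d ∘ₗ d) (A x) = A ((adjoint d₁ ∘ₗ d₁) x) := by
  have hA (x) : d (A x) = A' (d₁ x) := LinearMap.congr_fun hA x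
  have hB (y) : d (B y) = B' (d₂ y) := LinearMap.congr_fun hB y
  refine ext_inner_right 𝕜 fun z => ?_
  obtain ⟨⟨u, v⟩, rfl⟩ := hsurj z
  simp only [coprod_apply, comp_apply, adjoint_inner_left, inner_add_right, hA, hB,
    h.inner_left, h.inner_left_right, h'.inner_left, h'.inner_left_right]

variable [FiniteDimensional 𝕜 E₂] [FiniteDimensional 𝕜 F₂]

theorem charpoly_adjoint_comp_self (h : IsOrthogonalPair c A B) (h' : IsOrthogonalPair c A' B')
    (hc : c ≠ 0) (hsurj : Function.Surjective (A.coprod B)) (hA : d ∘ₗ A = A' ∘ₗ d₁)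
    (hB : d ∘ₗ B = B' ∘ₗ d₂) :
    (adjoint d ∘ₗ d).charpoly = (adjoint d₁ ∘ₗ d₁).charpoly * (adjoint d₂ ∘ₗ d₂).charpoly := by
  have hsurj' : Function.Surjective (B.coprod A) := fun z => by
    obtain ⟨⟨x, y⟩, rfl⟩ := hsurj z
    exact ⟨(y, x), by simp only [coprod_apply, add_comm]⟩
  let e := LinearEquiv.ofBijective (A.coprod B) ⟨h.injective_coprod hc, hsurj⟩
  rw [← charpoly_prodMap, ← LinearEquiv.charpoly_conj e]
  congr 1
  ext z
  obtain ⟨⟨x, y⟩, rfl⟩ := e.surjective z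
  rw [LinearEquiv.conj_apply_apply, LinearEquiv.symm_apply_apply]
  change (adjoint d ∘ₗ d) (A x + B y) = A ((adjoint d₁ ∘ₗ d₁) x) + B ((adjoint d₂ ∘ₗ d₂) y)
  rw [map_add, h.adjoint_comp_self_apply h' hsurj hA hB,
    h.symm.adjoint_comp_self_apply h'.symm hsurj' hB hA]

end IsOrthogonalPair

end LinearAlgebra

section DerivedGraph

variable {α β : Type*} {B : SimpleGraph α} {H : SimpleGraph β} {k : ℕ}

theorem exists_derivedGraph_iso (p : H →g B) (hcard : ∀ u, Nonempty (Fin k ≃ {x // p x = u}))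
    (hlift : ∀ u y, B.Adj u (p y) → ∃! x, p x = u ∧ H.Adj x y) :
    ∃ (ψ : B.PermVoltage k) (η : ψ.derivedGraph ≃g H), ∀ u a, p (η (u, a)) = u := by
  let q u := (hcard u).some
  have hex (d : B.Dart) (b : Fin k) : ∃ a, ∀ a', H.Adj (q d.fst a') (q d.snd b) ↔ a' = a := by
    obtain ⟨x, ⟨hx, hadj⟩, huniq⟩ := hlift d.fst (q d.snd b) (by rw [(q d.snd b).2]; exact d.adj)
    obtain ⟨a, ha⟩ := (q d.fst).surjective ⟨x, hx⟩
    have hax : (q d.fst a).1 = x := congr_arg Subtype.val ha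
    refine ⟨a, fun a' => ⟨fun h => ?_, ?_⟩⟩
    · exact (q d.fst).injective (Subtype.ext ((huniq _ ⟨(q d.fst a').2, h⟩).trans hax.symm))
    · rintro rfl
      rwa [hax]
  choose f hf using hex
  have hinv (d b) : f d.symm (f d b) = b :=
    ((hf d.symm (f d b) b).1 ((hf d b (f d b)).2 rfl).symm).symm
  let ψ : B.PermVoltage k :=
    { toFun d := ⟨f d, f d.symm, hinv d, hinv d.symm⟩
      map_symm _ := rfl }
  let η : α × Fin k ≃ β := (Equiv.sigmaEquivProd α (Fin k)).symm.trans <|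
    (Equiv.sigmaCongrRight q).trans (Equiv.sigmaFiberEquiv p)
  have hη (u a) : p (η (u, a)) = u := (q u a).2
  refine ⟨ψ, ⟨η, ?_⟩, hη⟩
  rintro ⟨u, a⟩ ⟨v, b⟩
  constructor
  · intro h
    have huv : B.Adj u v := by simpa only [hη] using p.map_adj h
    exact ⟨huv, (hf ⟨(u, v), huv⟩ b a).1 h⟩
  · rintro ⟨huv, hab⟩
    exact (hf ⟨(u, v), huv⟩ b a).2 hab

/-- `p` is two-to-one, and `ε` takes the values `1` and `-1` on the two points of each fibre. -/
def IsSheetSign (p : β → α) (ε : β → ℝ) : Prop :=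
  ∀ b, ∃ x y, ε x = 1 ∧ ε y = -1 ∧ ∀ z, p z = b ↔ z = x ∨ z = y

namespace IsSheetSign

variable {p : β → α} {ε : β → ℝ}

theorem comap (h : IsSheetSign p ε) {α' β' : Type*} {p' : β' → α'} {ι : β' → β} {κ : α' → α}
    (hι : Function.Injective ι) (hκ : Function.Injective κ) (hp : ∀ z, p (ι z) = κ (p' z))
    (hpullback : ∀ x b, p x = κ b → ∃ z, ι z = x) : IsSheetSign p' (ε ∘ ι) := by
  intro b
  obtain ⟨_, _, hεx, hεy, hb⟩ := h (κ b)
  obtain ⟨x, rfl⟩ := hpullback _ b ((hb _).2 (Or.inl rfl))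
  obtain ⟨y, rfl⟩ := hpullback _ b ((hb _).2 (Or.inr rfl))
  exact ⟨x, y, hεx, hεy, fun z => by rw [← hκ.eq_iff, ← hp, hb, hι.eq_iff, hι.eq_iff]⟩

theorem one_add_mul_eq_zero (h : IsSheetSign p ε) {x y : β} (hxy : p x = p y) (hne : x ≠ y) :
    1 + ε x * ε y = 0 := by
  obtain ⟨z, z', hz, hz', hfiber⟩ := h (p y)
  rcases (hfiber x).1 hxy with rfl | rfl <;> rcases (hfiber y).1 rfl with rfl | rfl
  · exact absurd rfl hne
  · rw [hz, hz']; norm_num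
  · rw [hz, hz']; norm_num
  · exact absurd rfl hne

theorem mul_self (h : IsSheetSign p ε) (x : β) : ε x * ε x = 1 := by
  obtain ⟨z, z', hz, hz', hfiber⟩ := h (p x)
  rcases (hfiber x).1 rfl with rfl | rfl
  · rw [hz, one_mul]
  · rw [hz', neg_one_mul, neg_neg]

theorem exists_filter_eq_pair [Fintype β] [DecidableEq α] [DecidableEq β] (h : IsSheetSign p ε)
    (b : α) : ∃ x y, ε x = 1 ∧ ε y = -1 ∧ x ≠ y ∧ ({z | p z = b} : Finset β) = {x, y} := by
  obtain ⟨x, y, hx, hy, hfiber⟩ := h b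
  refine ⟨x, y, hx, hy, ?_, Finset.ext fun z => ?_⟩
  · rintro rfl
    linarith
  · rw [Finset.mem_filter_univ, hfiber, Finset.mem_insert, Finset.mem_singleton]

theorem sum_fiber [Fintype β] [DecidableEq α] (h : IsSheetSign p ε) (b : α) :
    ∑ x with p x = b, ε x = 0 := by
  classical
  obtain ⟨x, y, hx, hy, hne, hfiber⟩ := h.exists_filter_eq_pair b
  rw [hfiber, Finset.sum_pair hne, hx, hy, add_neg_cancel]

theorem card_fiber [Fintype β] [DecidableEq α] (h : IsSheetSign p ε) (b : α) :
    Finset.card {x | p x = b} = 2 := by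
  classical
  obtain ⟨x, y, -, -, hne, hfiber⟩ := h.exists_filter_eq_pair b
  rw [hfiber, Finset.card_pair hne]

end IsSheetSign

/-- The sign `(-1) ^ a` of the point `η (u, a)`, where `η` numbers the two sheets by `0` and `1`. -/
def sheetSign (η : α × Fin 2 ≃ β) (x : β) : ℝ :=
  (-1) ^ ((η.symm x).2 : ℕ)

theorem sheetSign_apply (η : α × Fin 2 ≃ β) (u : α) (a : Fin 2) :
    sheetSign η (η (u, a)) = (-1) ^ (a : ℕ) := by
  rw [sheetSign, Equiv.symm_apply_apply]

theorem isSheetSign_sheetSign {p : β → α} {η : α × Fin 2 ≃ β} (hη : ∀ u a, p (η (u, a)) = u) :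
    IsSheetSign p (sheetSign η) := by
  refine fun u => ⟨η (u, 0), η (u, 1), by simp [sheetSign_apply], by simp [sheetSign_apply],
    fun z => ?_⟩
  obtain ⟨⟨v, a⟩, rfl⟩ := η.surjective z
  rw [hη, η.apply_eq_iff_eq, η.apply_eq_iff_eq, Prod.mk.injEq, Prod.mk.injEq, ← and_or_left]
  exact (and_iff_left (by omega)).symm

theorem neg_one_pow_perm_apply (σ : Equiv.Perm (Fin 2)) (b : Fin 2) :
    (-1 : ℤ) ^ (σ b : ℕ) = Equiv.Perm.sign σ * (-1) ^ (b : ℕ) := by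
  revert σ b
  decide

theorem sheetSign_eq_sign_mul {ψ : B.PermVoltage 2} {p : H →g B} {η : ψ.derivedGraph ≃g H}
    (hη : ∀ u a, p (η (u, a)) = u) {x y : β} (h : H.Adj x y) :
    sheetSign η.toEquiv x =
      ((Equiv.Perm.sign (ψ.toFun ⟨(p x, p y), p.map_adj h⟩) : ℤ) : ℝ) * sheetSign η.toEquiv y := by
  obtain ⟨⟨u, a⟩, rfl⟩ := η.surjective x
  obtain ⟨⟨v, b⟩, rfl⟩ := η.surjective y
  obtain ⟨huv, hab⟩ := η.map_adj_iff.1 h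
  have hsign := congr_arg (Int.cast : ℤ → ℝ) (neg_one_pow_perm_apply (ψ.toFun ⟨(u, v), huv⟩) b)
  push_cast at hsign
  have ha : sheetSign η.toEquiv (η (u, a)) = (-1) ^ (a : ℕ) := sheetSign_apply η.toEquiv u a
  have hb : sheetSign η.toEquiv (η (v, b)) = (-1) ^ (b : ℕ) := sheetSign_apply η.toEquiv v b
  have hpow := (congr_arg (fun c : Fin 2 => (-1 : ℝ) ^ (c : ℕ)) hab).trans hsign
  simp only [hη, ha, hb]
  exact hpow

end DerivedGraph

section Cochain

variable {V : Type*} {K : AbstractSimplicialComplex V} {w : K.FaceWeight} {i : ℕ}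

theorem mem_toFace {t : K.OrderedFace i} {v : V} : v ∈ t.toFace.1 ↔ ∃ j, t.1 j = v := by
  simp [OrderedFace.toFace]

/-- `OrderedFace.toFace`, remembering the dimension. -/
def underlyingFace (t : K.OrderedFace i) : K.Face i :=
  ⟨t.toFace, by simp [OrderedFace.toFace]⟩

theorem underlyingFace_perm (t : K.OrderedFace i) (σ : Equiv.Perm (Fin (i + 1))) :
    underlyingFace (t.perm σ) = underlyingFace t :=
  Subtype.ext (t.toFace_perm σ)

theorem underlyingFace_orient (F : K.Face i) : underlyingFace F.orient = F :=
  Subtype.ext F.toFace_orient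

theorem incident_erase (t : K.OrderedFace (i + 1)) (j : Fin (i + 2)) :
    (t.erase j).toFace.1.Incident t.toFace.1 := by
  refine ⟨fun v hv => ?_, by simp [OrderedFace.toFace]⟩
  obtain ⟨k, rfl⟩ := mem_toFace.1 hv
  exact mem_toFace.2 ⟨j.succAbove k, rfl⟩

theorem perm_perm_symm (t : K.OrderedFace i) (σ : Equiv.Perm (Fin (i + 1))) :
    (t.perm σ).perm σ.symm = t := by
  refine Subtype.ext (DFunLike.ext _ _ fun j => ?_)
  simp [OrderedFace.perm]

/-- The cochain with prescribed values on ordered faces. -/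
noncomputable def cochainOfAlternating (w : K.FaceWeight) (f : K.OrderedFace i → ℝ)
    (hf : ∀ t σ, f (t.perm σ) = ((Equiv.Perm.sign σ : ℤ) : ℝ) * f t) : K.Cochain w i :=
  (K.orientationRelations i).liftQ (Finsupp.linearCombination ℝ f) (by
    rw [orientationRelations, Submodule.span_le]
    rintro _ ⟨t, σ, rfl⟩
    simp [hf])

@[simp]
theorem eval_cochainOfAlternating {f : K.OrderedFace i → ℝ} {hf} (t : K.OrderedFace i) :
    (cochainOfAlternating w f hf).eval t = f t := by
  change (K.orientationRelations i).liftQ (Finsupp.linearCombination ℝ f) _ t.toChain = _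
  rw [OrderedFace.toChain, Submodule.mkQ_apply, Submodule.liftQ_apply,
    Finsupp.linearCombination_single, one_smul]

@[simp]
theorem eval_add (f g : K.Cochain w i) (t : K.OrderedFace i) :
    (f + g).eval t = f.eval t + g.eval t := rfl

@[simp]
theorem eval_smul (r : ℝ) (f : K.Cochain w i) (t : K.OrderedFace i) :
    (r • f).eval t = r * f.eval t := rfl

end Cochain

variable {V W : Type*} [DecidableEq W] {K : AbstractSimplicialComplex V}
  {M : AbstractSimplicialComplex W} {φ : SimplicialMap K M} {i : ℕ}

section Nondegenerate

/-- A nondegenerate simplicial map: no face is collapsed to a face of smaller dimension. -/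
def IsNondegenerate (φ : SimplicialMap K M) : Prop :=
  ∀ F : K, Set.InjOn φ.toFun F.1

theorem card_mapFace (hφ : IsNondegenerate φ) (F : K) : (φ.mapFace F).1.card = F.1.card :=
  Finset.card_image_of_injOn (hφ F)

theorem incident_mapFace (hφ : IsNondegenerate φ) {F F' : K} (h : F.1.Incident F'.1) :
    (φ.mapFace F).1.Incident (φ.mapFace F').1 :=
  ⟨Finset.image_subset_image h.1, by rw [card_mapFace hφ, card_mapFace hφ, h.2]⟩

/-- The map `S_i(K) → S_i(M)` induced by a nondegenerate simplicial map. -/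
def faceMap (hφ : IsNondegenerate φ) (F : K.Face i) : M.Face i :=
  ⟨φ.mapFace F.1, by rw [card_mapFace hφ, F.2]⟩

/-- The ordered face `(φ v₀, …, φ v_i)`. -/
def orderedFaceMap (hφ : IsNondegenerate φ) (t : K.OrderedFace i) : M.OrderedFace i :=
  ⟨⟨φ.toFun ∘ t.1, fun _ _ hab => t.1.injective <|
    hφ t.toFace (mem_toFace.2 ⟨_, rfl⟩) (mem_toFace.2 ⟨_, rfl⟩) hab⟩, by
    convert φ.image_mem _ t.2 using 1
    ext x
    simp only [Finset.mem_map, Finset.mem_image, Finset.mem_univ, true_and,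
      exists_exists_eq_and]
    rfl⟩

theorem toFace_orderedFaceMap (hφ : IsNondegenerate φ) (t : K.OrderedFace i) :
    (orderedFaceMap hφ t).toFace = φ.mapFace t.toFace := by
  refine Subtype.ext (Finset.ext fun x => ?_)
  rw [mem_toFace]
  simp only [mapFace, Finset.mem_image, mem_toFace, exists_exists_eq_and]
  rfl

theorem underlyingFace_orderedFaceMap (hφ : IsNondegenerate φ) (t : K.OrderedFace i) :
    underlyingFace (orderedFaceMap hφ t) = faceMap hφ (underlyingFace t) :=
  Subtype.ext (toFace_orderedFaceMap hφ t)

theorem orderedFaceMap_perm (hφ : IsNondegenerate φ) (t : K.OrderedFace i)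
    (σ : Equiv.Perm (Fin (i + 1))) :
    orderedFaceMap hφ (t.perm σ) = (orderedFaceMap hφ t).perm σ := rfl

theorem orderedFaceMap_erase (hφ : IsNondegenerate φ) (t : K.OrderedFace (i + 1))
    (j : Fin (i + 2)) : orderedFaceMap hφ (t.erase j) = (orderedFaceMap hφ t).erase j := rfl

theorem eq_of_orderedFaceMap_eq (hφ : IsNondegenerate φ) {t t' : K.OrderedFace i}
    (h : underlyingFace t = underlyingFace t') (hmap : orderedFaceMap hφ t = orderedFaceMap hφ t') :
    t = t' := by
  have h : t.toFace = t'.toFace := congr_arg Subtype.val h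
  refine Subtype.ext (DFunLike.ext _ _ fun j => ?_)
  exact hφ t.toFace (mem_toFace.2 ⟨j, rfl⟩) (h ▸ mem_toFace.2 ⟨j, rfl⟩)
    (congr_arg (fun u : M.OrderedFace i => u.1 j) hmap)

/-- Reordering by `σ`, as a bijection between fibres of `orderedFaceMap`. -/
def orderedFiberPerm (hφ : IsNondegenerate φ) (u : M.OrderedFace i)
    (σ : Equiv.Perm (Fin (i + 1))) :
    {t // orderedFaceMap hφ t = u} ≃ {t // orderedFaceMap hφ t = u.perm σ} where
  toFun t := ⟨t.1.perm σ, by rw [orderedFaceMap_perm, t.2]⟩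
  invFun t := ⟨t.1.perm σ.symm, by rw [orderedFaceMap_perm, t.2, perm_perm_symm]⟩
  left_inv t := Subtype.ext (perm_perm_symm t.1 σ)
  right_inv t := Subtype.ext (perm_perm_symm t.1 σ.symm)

end Nondegenerate

section TwistedPullback

variable {wK : K.FaceWeight} {wM : M.FaceWeight}

/-- The pullback of cochains along `φ`, multiplied by the function `ε` on the `i`-faces of `K`. -/
noncomputable def twistedPullback (hφ : IsNondegenerate φ) (ε : K.Face i → ℝ) (wK : K.FaceWeight)
    (wM : M.FaceWeight) : M.Cochain wM i →ₗ[ℝ] K.Cochain wK i where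
  toFun g := cochainOfAlternating wK
    (fun t => ε (underlyingFace t) * g.eval (orderedFaceMap hφ t)) fun t σ => by
      rw [underlyingFace_perm, orderedFaceMap_perm, Cochain.eval_perm, mul_left_comm]
  map_add' f g := Cochain.ext_eval fun t => by
    simp only [eval_cochainOfAlternating, eval_add, mul_add]
  map_smul' r f := Cochain.ext_eval fun t => by
    simp only [eval_cochainOfAlternating, eval_smul, mul_left_comm, RingHom.id_apply]

theorem eval_twistedPullback (hφ : IsNondegenerate φ) (ε : K.Face i → ℝ) (g : M.Cochain wM i)
    (t : K.OrderedFace i) : (twistedPullback hφ ε wK wM g).eval t =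
      ε (underlyingFace t) * g.eval (orderedFaceMap hφ t) := by
  simp only [twistedPullback, LinearMap.coe_mk, AddHom.coe_mk, eval_cochainOfAlternating]

theorem eval_twistedPullback_orient (hφ : IsNondegenerate φ) (ε : K.Face i → ℝ)
    (g : M.Cochain wM i) (F : K.Face i) : (twistedPullback hφ ε wK wM g).eval F.orient =
      ε F * g.eval (orderedFaceMap hφ F.orient) := by
  rw [eval_twistedPullback, underlyingFace_orient]

theorem coboundary_comp_twistedPullback [Finite V] [Finite W] (hφ : IsNondegenerate φ)
    {s : M.IncidenceSign} {ε : K.Face i → ℝ} {ε' : K.Face (i + 1) → ℝ}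
    (hε : ∀ F F', F.1.1.Incident F'.1.1 →
      ε F = ε' F' * (s.toFun (φ.mapFace F.1) (φ.mapFace F'.1) : ℝ)) :
    K.coboundary wK i ∘ₗ twistedPullback hφ ε wK wM =
      twistedPullback hφ ε' wK wM ∘ₗ M.signedCoboundary wM s i := by
  refine LinearMap.ext fun g => Cochain.ext_eval fun t => ?_
  rw [LinearMap.comp_apply, LinearMap.comp_apply, coboundary_eval, eval_twistedPullback,
    signedCoboundary_eval, Finset.mul_sum]
  refine Finset.sum_congr rfl fun j _ => ?_
  have hj : ε (underlyingFace (t.erase j)) = ε' (underlyingFace t) *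
      (s.toFun (φ.mapFace (t.erase j).toFace) (φ.mapFace t.toFace) : ℝ) :=
    hε _ _ (incident_erase t j)
  rw [eval_twistedPullback, hj, ← orderedFaceMap_erase, toFace_orderedFaceMap,
    toFace_orderedFaceMap]
  ring

theorem coboundary_comp_pullback [Finite V] [Finite W] (hφ : IsNondegenerate φ) :
    K.coboundary wK i ∘ₗ twistedPullback hφ 1 wK wM =
      twistedPullback hφ 1 wK wM ∘ₗ M.coboundary wM i :=
  coboundary_comp_twistedPullback (s := IncidenceSign.one M) hφ fun F F' h => by
    simp [IncidenceSign.one, incident_mapFace hφ h]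

open Classical in
theorem inner_twistedPullback [Finite V] [Finite W] (hφ : IsNondegenerate φ)
    (hw : ∀ F : K, wK.toFun F = wM.toFun (φ.mapFace F)) {ε ε' : K.Face i → ℝ} {c : ℝ}
    (hc : ∀ G, ∑ F with faceMap hφ F = G, ε F * ε' F = c) (f g : M.Cochain wM i) :
    inner ℝ (twistedPullback hφ ε wK wM f) (twistedPullback hφ ε' wK wM g) = c * inner ℝ f g := by
  rw [Cochain.inner_eq, Cochain.inner_eq, ← Finset.sum_fiberwise _ (faceMap hφ), Finset.mul_sum]
  refine Finset.sum_congr rfl fun G _ => ?_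
  rw [← hc G, Finset.sum_mul]
  refine Finset.sum_congr rfl fun F hF => ?_
  obtain rfl : faceMap hφ F = G := (Finset.mem_filter.1 hF).2
  have horient : f.eval (orderedFaceMap hφ F.orient) * g.eval (orderedFaceMap hφ F.orient) =
      f.eval (faceMap hφ F).orient * g.eval (faceMap hφ F).orient :=
    f.eval_mul_eval g (by
      rw [toFace_orderedFaceMap, Face.toFace_orient, Face.toFace_orient, faceMap])
  rw [eval_twistedPullback_orient, eval_twistedPullback_orient, hw, ← horient, faceMap]
  ring

open Classical in
theorem isOrthogonalPair_twistedPullback [Finite V] [Finite W] (hφ : IsNondegenerate φ)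
    (hw : ∀ F : K, wK.toFun F = wM.toFun (φ.mapFace F)) {ε : K.Face i → ℝ}
    (hε : IsSheetSign (faceMap hφ) ε) :
    IsOrthogonalPair (2 : ℝ) (twistedPullback hφ 1 wK wM) (twistedPullback hφ ε wK wM) where
  inner_left := inner_twistedPullback hφ hw fun G => by simp [hε.card_fiber]
  inner_right := inner_twistedPullback hφ hw fun G => by simp [hε.mul_self, hε.card_fiber]
  inner_left_right f g := by
    rw [inner_twistedPullback hφ hw (c := 0) (fun G => by simp [hε.sum_fiber]), zero_mul]

/-- The `ε`-weighted sum of a cochain over the fibres of `φ`. -/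
noncomputable def twistedTransfer (hφ : IsNondegenerate φ) (ε : K.Face i → ℝ)
    (wM : M.FaceWeight) (y : K.Cochain wK i) : M.Cochain wM i :=
  cochainOfAlternating wM
    (fun u => ∑ᶠ t : {t // orderedFaceMap hφ t = u}, ε (underlyingFace t.1) * y.eval t.1)
    fun u σ => by
      rw [← finsum_comp_equiv (orderedFiberPerm hφ u σ), mul_finsum]
      refine finsum_congr fun t => ?_
      change ε (underlyingFace (t.1.perm σ)) * y.eval (t.1.perm σ) = _
      rw [underlyingFace_perm, Cochain.eval_perm, mul_left_comm]

theorem twistedPullback_add_twistedPullback [Finite V] (hφ : IsNondegenerate φ)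
    {ε : K.Face i → ℝ} (hε : IsSheetSign (faceMap hφ) ε) (y : K.Cochain wK i) :
    twistedPullback hφ 1 wK wM (twistedTransfer hφ 1 wM y) +
      twistedPullback hφ ε wK wM (twistedTransfer hφ ε wM y) = (2 : ℝ) • y := by
  refine Cochain.ext_eval fun t => ?_
  have hzero (t' : {t' // orderedFaceMap hφ t' = orderedFaceMap hφ t}) (hne : t' ≠ ⟨t, rfl⟩) :
      (1 + ε (underlyingFace t) * ε (underlyingFace t'.1)) * y.eval t'.1 = 0 := by
    have hface : faceMap hφ (underlyingFace t) = faceMap hφ (underlyingFace t'.1) := by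
      rw [← underlyingFace_orderedFaceMap, ← underlyingFace_orderedFaceMap, t'.2]
    rw [hε.one_add_mul_eq_zero hface, zero_mul]
    exact fun h => hne (Subtype.ext (eq_of_orderedFaceMap_eq hφ h.symm t'.2))
  calc _ = ∑ᶠ t' : {t' // orderedFaceMap hφ t' = orderedFaceMap hφ t},
        (1 + ε (underlyingFace t) * ε (underlyingFace t'.1)) * y.eval t'.1 := by
        rw [eval_add, eval_twistedPullback, eval_twistedPullback, twistedTransfer,
          twistedTransfer, eval_cochainOfAlternating, eval_cochainOfAlternating,
          mul_finsum, mul_finsum,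
          ← finsum_add_distrib (Set.toFinite _) (Set.toFinite _)]
        refine finsum_congr fun t' => ?_
        simp only [Pi.one_apply]
        ring
    _ = 2 * y.eval t := by
        rw [finsum_eq_single _ ⟨t, rfl⟩ hzero, hε.mul_self, one_add_one_eq_two]

theorem surjective_coprod_twistedPullback [Finite V] (hφ : IsNondegenerate φ)
    {ε : K.Face i → ℝ} (hε : IsSheetSign (faceMap hφ) ε) : Function.Surjective
      ((twistedPullback hφ 1 wK wM).coprod (twistedPullback hφ ε wK wM)) := fun y =>
  ⟨(2⁻¹ : ℝ) • (twistedTransfer hφ 1 wM y, twistedTransfer hφ ε wM y), by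
    rw [map_smul, LinearMap.coprod_apply, twistedPullback_add_twistedPullback hφ hε,
      inv_smul_smul₀ two_ne_zero]⟩

end TwistedPullback

section Spectrum

/-- An `i`-face of `K` as a vertex of the incidence graph `B_i(K)`. -/
def lowerVertex (F : K.Face i) : K.IncidenceVertex i :=
  ⟨F.1, Or.inl F.2⟩

/-- An `(i+1)`-face of `K` as a vertex of the incidence graph `B_i(K)`. -/
def upperVertex (F : K.Face (i + 1)) : K.IncidenceVertex i :=
  ⟨F.1, Or.inr F.2⟩

theorem lowerVertex_injective : Function.Injective (lowerVertex : K.Face i → _) := fun _ _ h =>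
  Subtype.ext (Subtype.mk.inj h)

theorem upperVertex_injective : Function.Injective (upperVertex : K.Face (i + 1) → _) :=
  fun _ _ h => Subtype.ext (Subtype.mk.inj h)

/-- The homomorphism `B_i(K) → B_i(M)` of incidence graphs induced by `φ`. -/
def incidenceMap (hφ : IsNondegenerate φ) (i : ℕ) : K.incidenceGraph i →g M.incidenceGraph i where
  toFun F := ⟨φ.mapFace F.1, by rw [card_mapFace hφ]; exact F.2⟩
  map_rel' h := h.imp (incident_mapFace hφ) (incident_mapFace hφ)

theorem card_eq_of_incidenceMap_eq (hφ : IsNondegenerate φ) {F : K.IncidenceVertex i}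
    {G : M.IncidenceVertex i} (h : incidenceMap hφ i F = G) : F.1.1.card = G.1.1.card := by
  rw [← h, ← card_mapFace hφ]
  rfl

theorem adj_iff_incident {F F' : K.IncidenceVertex i} (h : F'.1.1.card = F.1.1.card + 1) :
    (K.incidenceGraph i).Adj F F' ↔ F.1.1.Incident F'.1.1 :=
  or_iff_left fun h' => by have := h'.2; omega

theorem isSheetSign_comp_lowerVertex (hφ : IsNondegenerate φ) {ε : K.IncidenceVertex i → ℝ}
    (hε : IsSheetSign (incidenceMap hφ i) ε) : IsSheetSign (faceMap hφ) (ε ∘ lowerVertex) :=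
  hε.comap lowerVertex_injective lowerVertex_injective (fun _ => rfl) fun F G h =>
    ⟨⟨F.1, (card_eq_of_incidenceMap_eq hφ h).trans G.2⟩, rfl⟩

theorem isSheetSign_comp_upperVertex (hφ : IsNondegenerate φ) {ε : K.IncidenceVertex i → ℝ}
    (hε : IsSheetSign (incidenceMap hφ i) ε) : IsSheetSign (faceMap hφ) (ε ∘ upperVertex) :=
  hε.comap upperVertex_injective upperVertex_injective (fun _ => rfl) fun F G h =>
    ⟨⟨F.1, (card_eq_of_incidenceMap_eq hφ h).trans G.2⟩, rfl⟩

theorem sheetSign_lowerVertex (hφ : IsNondegenerate φ) {ψ : (M.incidenceGraph i).PermVoltage 2}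
    {η : ψ.derivedGraph ≃g K.incidenceGraph i} (hη : ∀ G a, incidenceMap hφ i (η (G, a)) = G)
    {s : M.IncidenceSign} (hs : s.IsSignOf ψ) {F : K.Face i} {F' : K.Face (i + 1)}
    (h : F.1.1.Incident F'.1.1) :
    sheetSign η.toEquiv (lowerVertex F) = sheetSign η.toEquiv (upperVertex F') *
      (s.toFun (φ.mapFace F.1) (φ.mapFace F'.1) : ℝ) := by
  have hadj : (K.incidenceGraph i).Adj (lowerVertex F) (upperVertex F') := Or.inl h
  have hsign := congr_arg (Int.cast : ℤ → ℝ)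
    (hs ⟨(_, _), (incidenceMap hφ i).map_adj hadj⟩ (incident_mapFace hφ h))
  rw [sheetSign_eq_sign_mul hη hadj, mul_comm, ← hsign]
  congr 1
  exact SignType.intCast_cast _

variable [Finite V] [Finite W] {wK : K.FaceWeight} {wM : M.FaceWeight}

theorem specMultiset_upLaplacian_of_isDerivedBy (hφ : IsNondegenerate φ)
    (hw : ∀ F : K, wK.toFun F = wM.toFun (φ.mapFace F))
    {ψ : (M.incidenceGraph i).PermVoltage 2} {s : M.IncidenceSign}
    (hψ : φ.IsDerivedBy ψ) (hs : s.IsSignOf ψ) :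
    (K.upLaplacian wK i).specMultiset =
      (M.upLaplacian wM i).specMultiset + (M.signedUpLaplacian wM s i).specMultiset := by
  obtain ⟨η, hη⟩ := hψ
  have hη (G a) : incidenceMap hφ i (η (G, a)) = G := Subtype.ext (hη G a)
  have hε : IsSheetSign (incidenceMap hφ i) (sheetSign η.toEquiv) := isSheetSign_sheetSign hη
  have hlower := isSheetSign_comp_lowerVertex hφ hε
  have hupper := isSheetSign_comp_upperVertex hφ hε
  exact specMultiset_eq_add_of_charpoly_eq_mul <|
    (isOrthogonalPair_twistedPullback hφ hw hlower).charpoly_adjoint_comp_self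
      (isOrthogonalPair_twistedPullback hφ hw hupper) two_ne_zero
      (surjective_coprod_twistedPullback hφ hlower) (coboundary_comp_pullback hφ)
      (coboundary_comp_twistedPullback hφ fun _ _ => sheetSign_lowerVertex hφ hη hs)

end Spectrum

section Covering

variable {k : ℕ}

/-- A `k`-fold strong covering whose total complex need not be connected.  Since `Nat.card`
is `0` on infinite types, `k = 0` also allows infinite fibres. -/
structure IsSheetedCovering (φ : SimplicialMap K M) (k : ℕ) : Prop where
  nondegenerate : IsNondegenerate φ
  lift : ∀ (F : K) (G' : M), (φ.mapFace F).1.Incident G'.1 →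
    ∃ F' : K, φ.mapFace F' = G' ∧ F.1.Incident F'.1
  card_fiber : ∀ G : M, Nat.card {F : K // φ.mapFace F = G} = k

theorem isSheetedCovering_of_isFoldCovering (hφ : φ.IsFoldCovering k) : IsSheetedCovering φ k where
  nondegenerate F := (hφ.bijOn _ F rfl).injOn
  lift F G' h := (hφ.lift _ G' h F rfl).imp fun _ => And.symm
  card_fiber := hφ.card_fiber

theorem existsUnique_incident_mapFace_eq (hφ : IsNondegenerate φ) {G : M} {F' : K}
    (h : G.1.Incident (φ.mapFace F').1) : ∃! F : K, φ.mapFace F = G ∧ F.1.Incident F'.1 := by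
  obtain ⟨F, hF, hFG⟩ := Finset.subset_image_iff.1 h.1
  have hne : F.Nonempty := by
    rw [← Finset.image_nonempty (f := φ.toFun), hFG]
    exact (M.isRelLowerSet_faces G.2).1
  let F : K := ⟨F, (K.isRelLowerSet_faces F'.2).2 hF hne⟩
  have hFG : φ.mapFace F = G := Subtype.ext hFG
  have hcard : F'.1.card = F.1.card + 1 := by
    rw [← card_mapFace hφ F, ← card_mapFace hφ F', hFG, h.2]
  refine ⟨F, ⟨hFG, hF, hcard⟩, fun E hE => Subtype.ext ?_⟩
  exact Finset.image_injOn_powerset_of_injOn (hφ F') (Finset.mem_powerset.2 hE.2.1)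
    (Finset.mem_powerset.2 hF) (congr_arg Subtype.val (hE.1.trans hFG.symm))

namespace IsSheetedCovering

variable [NeZero k] (hφ : IsSheetedCovering φ k)
include hφ

theorem finite_fiber (G : M) : Finite {F : K // φ.mapFace F = G} :=
  Nat.finite_of_card_ne_zero (by rw [hφ.card_fiber]; exact NeZero.ne k)

/-- Passing to subfaces maps the fibre over `G'` onto the fibre over `φ(F)`; the fibres have the
same size, so this map is injective. -/
theorem existsUnique_incident {F : K} {G' : M} (h : (φ.mapFace F).1.Incident G'.1) :
    ∃! F' : K, φ.mapFace F' = G' ∧ F.1.Incident F'.1 := by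
  have hsub (F' : {F' // φ.mapFace F' = G'}) :
      ∃! E : K, φ.mapFace E = φ.mapFace F ∧ E.1.Incident F'.1.1 :=
    existsUnique_incident_mapFace_eq hφ.nondegenerate (by rwa [F'.2])
  choose f hf hfuniq using hsub
  let g (F' : {F' // φ.mapFace F' = G'}) : {E // φ.mapFace E = φ.mapFace F} := ⟨f F', (hf F').1⟩
  have hg {F'} {E : {E // φ.mapFace E = φ.mapFace F}} (h : E.1.1.Incident F'.1.1) : g F' = E :=
    Subtype.ext (hfuniq F' E.1 ⟨E.2, h⟩).symm
  have hsurj : Function.Surjective g := fun E => by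
    obtain ⟨F', hF', hE⟩ := hφ.lift E.1 G' (by rwa [E.2])
    exact ⟨⟨F', hF'⟩, hg hE⟩
  have := hφ.finite_fiber G'
  have hbij : Function.Bijective g := hsurj.bijective_of_nat_card_le <| by
    rw [hφ.card_fiber, hφ.card_fiber]
  obtain ⟨F', hF', hF⟩ := hφ.lift F G' h
  refine ⟨F', ⟨hF', hF⟩, fun E' hE' => ?_⟩
  exact congr_arg Subtype.val <| hbij.injective (a₁ := ⟨E', hE'.1⟩) (a₂ := ⟨F', hF'⟩) <|
    (hg (E := ⟨F, rfl⟩) hE'.2).trans (hg (E := ⟨F, rfl⟩) hF).symm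

theorem existsUnique_adj {G : M.IncidenceVertex i} {F : K.IncidenceVertex i}
    (h : (M.incidenceGraph i).Adj G (incidenceMap hφ.nondegenerate i F)) :
    ∃! E, incidenceMap hφ.nondegenerate i E = G ∧ (K.incidenceGraph i).Adj E F := by
  have hF : (φ.mapFace F.1).1.card = F.1.1.card := card_mapFace hφ.nondegenerate F.1
  have hcard {E} (hE : incidenceMap hφ.nondegenerate i E = G) : E.1.1.card = G.1.1.card :=
    card_eq_of_incidenceMap_eq hφ.nondegenerate hE
  have hvertex {E : K} (hE : φ.mapFace E = G.1) : E.1.card = i + 1 ∨ E.1.card = i + 2 := by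
    rw [← card_mapFace hφ.nondegenerate, hE]
    exact G.2
  rcases h with h | h
  · obtain ⟨E, ⟨hE, hEF⟩, huniq⟩ := existsUnique_incident_mapFace_eq hφ.nondegenerate h
    refine ⟨⟨E, hvertex hE⟩, ⟨Subtype.ext hE, Or.inl hEF⟩, fun E' ⟨hE', hadj⟩ => ?_⟩
    have hEF' := (adj_iff_incident (by rw [hcard hE', ← hF]; exact h.2)).1 hadj
    exact Subtype.ext (huniq E'.1 ⟨congr_arg Subtype.val hE', hEF'⟩)
  · obtain ⟨E, ⟨hE, hFE⟩, huniq⟩ := hφ.existsUnique_incident h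
    refine ⟨⟨E, hvertex hE⟩, ⟨Subtype.ext hE, Or.inr hFE⟩, fun E' ⟨hE', hadj⟩ => ?_⟩
    have hFE' := (adj_iff_incident (by rw [hcard hE', ← hF]; exact h.2)).1 hadj.symm
    exact Subtype.ext (huniq E'.1 ⟨congr_arg Subtype.val hE', hFE'⟩)

theorem nonempty_equiv_fiber (G : M.IncidenceVertex i) :
    Nonempty (Fin k ≃ {F // incidenceMap hφ.nondegenerate i F = G}) := by
  have := hφ.finite_fiber G.1
  refine ⟨(Finite.equivFinOfCardEq (hφ.card_fiber G.1)).symm.trans <| Equiv.symm <|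
    (Equiv.subtypeEquivRight fun F => Subtype.ext_iff).trans <|
      Equiv.subtypeSubtypeEquivSubtype fun {F} (hF : φ.mapFace F = G.1) => ?_⟩
  rw [← card_mapFace hφ.nondegenerate, hF]
  exact G.2

theorem exists_isDerivedBy (i : ℕ) :
    ∃ ψ : (M.incidenceGraph i).PermVoltage k, φ.IsDerivedBy ψ := by
  obtain ⟨ψ, η, hη⟩ := exists_derivedGraph_iso (incidenceMap hφ.nondegenerate i)
    hφ.nonempty_equiv_fiber fun _ _ => hφ.existsUnique_adj
  exact ⟨ψ, η, fun G a => congr_arg Subtype.val (hη G a)⟩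

end IsSheetedCovering

end Covering

section IncidenceSign

open Classical in
theorem exists_isSignOf {V : Type*} {M : AbstractSimplicialComplex V} {i k : ℕ}
    (ψ : (M.incidenceGraph i).PermVoltage k) : ∃ s : M.IncidenceSign, s.IsSignOf ψ := by
  let s (F F' : M) : SignType :=
    if h : F.1.Incident F'.1 ∧ F.1.card = i + 1 then
      SignType.sign (Equiv.Perm.sign (ψ.toFun
        ⟨(⟨F, Or.inl h.2⟩, ⟨F', Or.inr (by rw [h.1.2, h.2])⟩), Or.inl h.1⟩) : ℤ)
    else (IncidenceSign.one M).toFun F F'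
  refine ⟨⟨s, fun F F' => ?_⟩, fun e he => ?_⟩
  · by_cases h : F.1.Incident F'.1 ∧ F.1.card = i + 1
    · simp [s, h]
    · simp only [s, dif_neg h, (IncidenceSign.one M).ne_zero_iff]
  · have hcard : e.fst.1.1.card = i + 1 := by
      have := he.2
      have := e.fst.2
      have := e.snd.2
      omega
    simp only [s, dif_pos (And.intro he hcard)]
    rcases Int.units_eq_one_or (Equiv.Perm.sign (ψ.toFun e)) with h | h <;> simp [h]

end IncidenceSign

end SimplicialCovering

theorem theorem1p5_general {V W : Type*} [Finite V] [Finite W] [DecidableEq W]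
    (K : AbstractSimplicialComplex V) (M : AbstractSimplicialComplex W)
    (φ : AbstractSimplicialComplex.SimplicialMap K M)
    (hφ : SimplicialCovering.IsSheetedCovering φ 2)
    (wK : K.FaceWeight) (wM : M.FaceWeight)
    (hw : ∀ F : K, wK.toFun F = wM.toFun (φ.mapFace F)) (i : ℕ) :
    (∃ (ψ : (M.incidenceGraph i).PermVoltage 2) (s : M.IncidenceSign),
      φ.IsDerivedBy ψ ∧ s.IsSignOf ψ) ∧
    ∀ (ψ : (M.incidenceGraph i).PermVoltage 2) (s : M.IncidenceSign),
      φ.IsDerivedBy ψ → s.IsSignOf ψ →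
        (K.upLaplacian wK i).specMultiset =
          (M.upLaplacian wM i).specMultiset + (M.signedUpLaplacian wM s i).specMultiset := by
  constructor
  · obtain ⟨ψ, hψ⟩ := hφ.exists_isDerivedBy i
    obtain ⟨s, hs⟩ := SimplicialCovering.exists_isSignOf ψ
    exact ⟨ψ, s, hψ, hs⟩
  · intro ψ s hψ hs
    exact SimplicialCovering.specMultiset_upLaplacian_of_isDerivedBy hφ.nondegenerate hw hψ hs

theorem theorem1p5 {V W : Type*} [Fintype V] [Fintype W] [DecidableEq W]
    (K : AbstractSimplicialComplex V) (M : AbstractSimplicialComplex W)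
    (φ : AbstractSimplicialComplex.SimplicialMap K M) (hφ : φ.IsFoldCovering 2)
    (wK : K.FaceWeight) (wM : M.FaceWeight)
    (hw : ∀ F : K, wK.toFun F = wM.toFun (φ.mapFace F)) (i : ℕ) :
    (∃ (ψ : (M.incidenceGraph i).PermVoltage 2) (s : M.IncidenceSign),
      φ.IsDerivedBy ψ ∧ s.IsSignOf ψ) ∧
    ∀ (ψ : (M.incidenceGraph i).PermVoltage 2) (s : M.IncidenceSign),
      φ.IsDerivedBy ψ → s.IsSignOf ψ →
        (K.upLaplacian wK i).specMultiset =
          (M.upLaplacian wM i).specMultiset + (M.signedUpLaplacian wM s i).specMultiset := by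
  exact theorem1p5_general K M φ
    (SimplicialCovering.isSheetedCovering_of_isFoldCovering hφ) wK wM hw i
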